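/- Let $G$ be a locally compact Hausdorff group, and let $\omega$ be a regular complex Borel measure on $G$ with total variation norm $\|\omega\|=|\omega|(G)\le 1$, where $|\omega|$ denotes the variation measure of $\omega$. For a bounded continuous function $f:G\to\mathbb{C}$ put $$(L_\omega f)(t)=\int_G f(st)\,d\omega(s),\qquad (\ell_s f)(t)=f(st)\qquad(s,t\in G).$$ Let $\mathrm{LUC}(G)$ be the set of bounded continuous $f:G\to\mathbb{C}$ for which $s\mapsto \ell_s f$ is continuous with respect to the supremum norm, and let $\mathrm{WAP}(G)$ be the set of bounded continuous $f:G\to\mathbb{C}$ for which $\{\ell_s f: s\in G\}$ is relatively weakly compact in the Banach space of bounded continuous functions on $G$. Let $\operatorname{Fix}L_\omega$ denote the set of bounded continuous functions $f$ with $L_\omega f=f$. Let $G_{|\omega|}$ be the closed subgroup of $G$ generated by $\operatorname{supp}|\omega|$. For a continuous character (continuous homomorphism) $\chi:G_{|\omega|}\to\mathbb{T}$ let $$\mathrm{LUC}_{\chi,G_{|\omega|}}(G)=\{f\in \mathrm{LUC}(G): f(st)=\overline{\chi(s)}f(t)\ \text{for all } s\in G_{|\omega|},\ t\in G\},$$ $$\mathrm{WAP}_{\chi,G_{|\omega|}}(G)=\mathrm{WAP}(G)\cap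 \mathrm{LUC}_{\chi,G_{|\omega|}}(G).$$ (i) If $G$ is abelian and $L_\omega$ has a non-zero fixed point in $\mathrm{LUC}(G)$, then there is a continuous character $\chi:G_{|\omega|}\to\mathbb{T}$ such that $\omega=\chi|\omega|$ and $$\operatorname{Fix}L_\omega\cap \mathrm{LUC}(G)=\mathrm{LUC}_{\chi,G_{|\omega|}}(G).$$ (ii) For general $G$, if $L_\omega$ has a non-zero fixed point in $\mathrm{WAP}(G)$, then there is a continuous character $\chi:G_{|\omega|}\to\mathbb{T}$ such that $\omega=\chi|\omega|$ and $$\operatorname{Fix}L_\omega\cap \mathrm{WAP}(G)=\mathrm{WAP}_{\chi,G_{|\omega|}}(G).$$ Moreover, $\chi$ is the restriction to $G_{|\omega|}$ of a function in $\mathrm{WAP}(G)$. Here $\omega=\chi|\omega|$ means that $\omega$ has density with respect to $|\omega|$ equal to $\chi$ extended by zero off $G_{|\omega|}$. -/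

import Mathlib

open MeasureTheory Topology BoundedContinuousFunction

noncomputable section

namespace ConvFix

variable {G : Type*} [Group G] [TopologicalSpace G] [IsTopologicalGroup G]

/-- The left translate `ℓ_s f`, given by `(ℓ_s f) t = f (s * t)`. -/
def leftTranslate (s : G) (f : G →ᵇ ℂ) : G →ᵇ ℂ :=
  f.compContinuous (ContinuousMap.mulLeft s)

/-- `LUC(G)`: the bounded continuous functions `f` for which `s ↦ ℓ_s f` is continuous from `G`
to the bounded continuous functions with the supremum norm. -/
def LUC (G : Type*) [Group G] [TopologicalSpace G] [IsTopologicalGroup G] : Set (G →ᵇ ℂ) :=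
  {f | Continuous fun s : G => leftTranslate s f}

/-- `WAP(G)`: the bounded continuous functions `f` whose set of translates `{ℓ_s f : s ∈ G}` is
relatively compact in the weak topology of the Banach space of bounded continuous functions. -/
def WAP (G : Type*) [Group G] [TopologicalSpace G] [IsTopologicalGroup G] : Set (G →ᵇ ℂ) :=
  {f | IsCompact (closure (toWeakSpace ℂ (G →ᵇ ℂ) '' Set.range fun s : G => leftTranslate s f))}

/-- The convolution operator `(L_ω f)(t) = ∫ f(st) dω(s)`. -/
def convOp [MeasurableSpace G] (ω : ComplexMeasure G) (f : G → ℂ) : G → ℂ :=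
  fun t => VectorMeasure.integral ω (fun s => f (s * t)) (ContinuousLinearMap.mul ℝ ℂ)

/-- The bounded continuous fixed points of `L_ω`. -/
def fixedPoints [MeasurableSpace G] (ω : ComplexMeasure G) : Set (G →ᵇ ℂ) :=
  {f | convOp ω f = f}

/-- `G_μ`: the closed subgroup of `G` generated by the support of `μ`. -/
def generatedSubgroup [MeasurableSpace G] (μ : Measure G) : Subgroup G :=
  (Subgroup.closure μ.support).topologicalClosure

/-- `LUC_{χ,H}(G) = {f ∈ LUC(G) : f(st) = conj(χ(s)) f(t) for s ∈ H, t ∈ G}`, for a continuous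
character `χ` of a subgroup `H`. -/
def LUCChar (H : Subgroup G) (χ : H →ₜ* Circle) : Set (G →ᵇ ℂ) :=
  {f | f ∈ LUC G ∧ ∀ (s : H) (t : G), f ((s : G) * t) = starRingEnd ℂ (χ s : ℂ) * f t}

/-- `WAP_{χ,H}(G) = WAP(G) ∩ LUC_{χ,H}(G)`. -/
def WAPChar (H : Subgroup G) (χ : H →ₜ* Circle) : Set (G →ᵇ ℂ) :=
  WAP G ∩ LUCChar H χ

/-- The complex measure `χ μ` for a character `χ` of a subgroup `H` (in the cases of interest `H`
is closed, `μ` is finite and vanishes outside `H`): it has density with respect to `μ` the extension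
of `χ` by zero. -/
def charMeasure [MeasurableSpace G] (H : Subgroup G) (χ : H →ₜ* Circle) (μ : Measure G) :
    ComplexMeasure G :=
  μ.withDensityᵥ (Function.extend (Subtype.val : H → G) (fun s => (χ s : ℂ)) 0)

end ConvFix

end

/-!
Write `ω = h |ω|` with `|h| = 1` (`ComplexMeasure.exists_unimodular_density`), so that a fixed point
satisfies `f(t) = ∫ f(st) h(s) d|ω|(s)`; if `f ≠ 0`, then `|ω|` is a probability measure. The
theorem follows once this average is known to be trivial, that is, `h(s) f(st) = f(t)` for almost
every `s`. Indeed, the elements `s` that act on `f` (and on all other fixed points of the class) by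
a common unimodular scalar form a closed subgroup, which contains the support of `|ω|` and hence the
subgroup it generates; the conjugate of this scalar is a continuous character that agrees with `h`
almost everywhere (`exists_character`). It is a conjugated right translate of `f`, divided by a
value of `f`, which gives the extension to a function in `WAP(G)`.

For abelian `G` and `f` in `LUC(G)` triviality is the Choquet–Deny theorem (`ae_mul_eq_of_LUC`). The
variance `V = ∫ |h(s) ℓ_s f - f|² d|ω|(s)` equals `P|f|² - |f|²`, where `P` is averaging of
translates with respect to `|ω|`. Since each `h(s) ℓ_s f - f` is itself a fixed point, `V ≤ P V`, so
the telescoping sum of the `Pᵏ V` is at least `n V`; as it is bounded, `V = 0`. Uniform continuity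
makes the translates Bochner integrable in the space of bounded continuous functions, which replaces
Fubini's theorem on groups without countability assumptions.

For general `G` and `f` in `WAP(G)` the argument is geometric (`ae_smul_leftTranslate_eq_of_WAP`).
The orbit closure is weakly compact, hence dentable: it has slices of arbitrarily small norm
diameter (`exists_small_slice`). The average expresses a translate of `f` lying deep in such a slice
as a barycentre of twisted translates, most of which must lie in the same slice; since translations
are isometric, `h(s) ℓ_s f` is close to `f` for almost every `s`. Both dentability and the inclusion
of `WAP(G)` in `LUC(G)` rest on the fact that a weakly continuous map on a locally compact space has
small norm oscillation on some nonempty open set (`exists_isOpen_norm_sub_le`).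
-/

/-! ### Polar decomposition of complex measures -/

/-- The Radon–Nikodym theorem for a complex measure and its variation. -/
theorem MeasureTheory.ComplexMeasure.withDensityᵥ_rnDeriv_variation {α : Type*} [MeasurableSpace α]
    (ω : ComplexMeasure α) [IsFiniteMeasure ω.variation] :
    ω.variation.withDensityᵥ (ω.rnDeriv ω.variation) = ω := by
  have hre : ω.variation.withDensityᵥ ((ComplexMeasure.re ω).rnDeriv ω.variation)
      = ComplexMeasure.re ω := by
    apply SignedMeasure.withDensityᵥ_rnDeriv_eq
    refine VectorMeasure.AbsolutelyContinuous.mk fun i hi h0 => ?_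
    rw [Measure.toENNRealVectorMeasure_apply_measurable hi] at h0
    have : ω i = 0 := (VectorMeasure.variation_apply_eq_zero hi).1 h0 i subset_rfl hi
    change (ω i).re = 0
    simp [this]
  have him : ω.variation.withDensityᵥ ((ComplexMeasure.im ω).rnDeriv ω.variation)
      = ComplexMeasure.im ω := by
    apply SignedMeasure.withDensityᵥ_rnDeriv_eq
    refine VectorMeasure.AbsolutelyContinuous.mk fun i hi h0 => ?_
    rw [Measure.toENNRealVectorMeasure_apply_measurable hi] at h0
    have : ω i = 0 := (VectorMeasure.variation_apply_eq_zero hi).1 h0 i subset_rfl hi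
    change (ω i).im = 0
    simp [this]
  have hint := ω.integrable_rnDeriv ω.variation
  ext i hi : 1
  rw [withDensityᵥ_apply hint hi]
  apply Complex.ext
  · rw [← RCLike.re_eq_complex_re, ← integral_re hint.integrableOn]
    have := congrArg (fun v => v i) hre
    rw [withDensityᵥ_apply (SignedMeasure.integrable_rnDeriv _ _) hi] at this
    exact this
  · rw [← RCLike.im_eq_complex_im, ← integral_im hint.integrableOn]
    have := congrArg (fun v => v i) him
    rw [withDensityᵥ_apply (SignedMeasure.integrable_rnDeriv _ _) hi] at this
    exact this

/-- Polar decomposition: the Radon–Nikodym density has modulus one almost everywhere, since the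
variation of `ω` has density `‖dω/d|ω|‖` with respect to itself; it is changed on a null set. -/
theorem MeasureTheory.ComplexMeasure.exists_unimodular_density {α : Type*} [MeasurableSpace α]
    (ω : ComplexMeasure α) [IsFiniteMeasure ω.variation] :
    ∃ h : α → ℂ, Measurable h ∧ (∀ x, ‖h x‖ = 1) ∧ ω = ω.variation.withDensityᵥ h := by
  set μ := ω.variation with hμ
  have hint := ω.integrable_rnDeriv μ
  have hrn : μ.withDensityᵥ (ω.rnDeriv μ) = ω := ω.withDensityᵥ_rnDeriv_variation
  have hvar := Measure.variation_withDensityᵥ hint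
  rw [hrn, ← hμ] at hvar
  have h1 : (fun x => ‖ω.rnDeriv μ x‖ₑ) =ᵐ[μ] fun _ => 1 := by
    rw [← withDensity_eq_iff hint.aestronglyMeasurable.enorm aemeasurable_const, ← hvar,
      withDensity_const, one_smul]
    exact hint.2.ne
  obtain ⟨k, hk, hek⟩ := hint.aestronglyMeasurable
  classical
  refine ⟨fun x => if ‖k x‖ = 1 then k x else 1, ?_, ?_, ?_⟩
  · exact Measurable.ite (measurableSet_eq_fun hk.measurable.norm measurable_const) hk.measurable
      measurable_const
  · intro x
    by_cases hx : ‖k x‖ = 1 <;> simp [hx]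
  · conv_lhs => rw [← hrn]
    apply WithDensityᵥEq.congr_ae
    filter_upwards [h1, hek] with x hx hx'
    have : ‖k x‖ = 1 := by
      rw [← hx', ← toReal_enorm, hx]; simp
    rw [if_pos this, hx']

/-- Integration against `ω` is Bochner integration against `|ω|` after multiplying by the polar
density. -/
theorem MeasureTheory.ComplexMeasure.integral_mul_eq_integral_density {α : Type*}
    [MeasurableSpace α] {ω : ComplexMeasure α} [IsFiniteMeasure ω.variation] {h : α → ℂ}
    (hm : Measurable h) (h1 : ∀ x, ‖h x‖ = 1) (hω : ω = ω.variation.withDensityᵥ h) {f : α → ℂ}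
    (hf : Integrable f ω.variation) :
    ω.integral f (ContinuousLinearMap.mul ℝ ℂ) = ∫ s, f s * h s ∂ω.variation := by
  have hhint : Integrable h ω.variation :=
    Integrable.of_bound hm.aestronglyMeasurable 1 (by simp [h1])
  have hmul : ∀ {g : α → ℂ}, Integrable g ω.variation →
      Integrable (fun s => g s * h s) ω.variation := fun hg =>
    hg.mul_bdd (c := 1) hm.aestronglyMeasurable (by simp [h1])
  revert f
  apply Integrable.induction
  · intro c s hs _
    rw [VectorMeasure.integral_indicator_const c hs]
    have : (fun x => s.indicator (fun _ => c) x * h x) = s.indicator (fun x => c * h x) := by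
      ext x; by_cases hx : x ∈ s <;> simp [hx]
    rw [this, MeasureTheory.integral_indicator hs, MeasureTheory.integral_const_mul]
    conv_lhs => rw [hω]
    rw [withDensityᵥ_apply hhint hs]
    rfl
  · intro f g _ hf hg hf' hg'
    rw [VectorMeasure.integral_add hf hg, hf', hg',
      ← MeasureTheory.integral_add (hmul hf) (hmul hg)]
    simp [add_mul]
  · apply isClosed_eq VectorMeasure.continuous_integral
    have : Continuous fun f : α →₁[ω.variation] ℂ => (∫ s, f s * h s ∂ω.variation) := by
      rw [Metric.continuous_iff]
      intro f ε hε
      refine ⟨ε, hε, fun g hg => ?_⟩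
      rw [dist_eq_norm, ← MeasureTheory.integral_sub (hmul (L1.integrable_coeFn g))
        (hmul (L1.integrable_coeFn f))]
      refine lt_of_le_of_lt ?_ hg
      rw [L1.dist_eq_integral_dist]
      refine (MeasureTheory.norm_integral_le_integral_norm _).trans_eq ?_
      congr 1 with s
      rw [← sub_mul, norm_mul, h1, mul_one, dist_eq_norm]
    exact this
  · intro f g hfg hf hf'
    rw [← VectorMeasure.integral_congr_ae hfg, hf']
    apply MeasureTheory.integral_congr_ae
    filter_upwards [hfg] with x hx
    rw [hx]

/-! ### Measurability for regular measures -/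

/-- No countability is needed on either side: a finite regular measure is carried by a `σ`-compact
set, whose image under a continuous map is separable. -/
theorem Continuous.aestronglyMeasurable_of_regular {Y E : Type*} [TopologicalSpace Y]
    [T2Space Y] [MeasurableSpace Y] [BorelSpace Y] [TopologicalSpace E]
    [TopologicalSpace.PseudoMetrizableSpace E] {μ : Measure Y} [IsFiniteMeasure μ] [μ.Regular]
    {F : Y → E} (hF : Continuous F) : AEStronglyMeasurable F μ := by
  have hK : ∀ n : ℕ, ∃ K : Set Y, IsCompact K ∧ μ Kᶜ < ((n : ENNReal) + 1)⁻¹ := fun n => by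
    obtain ⟨K, -, hK, hμ⟩ := (MeasurableSet.univ (α := Y)).exists_isCompact_sdiff_lt
      (measure_ne_top μ _) (ε := ((n : ENNReal) + 1)⁻¹) (by simp)
    exact ⟨K, hK, by rwa [Set.compl_eq_univ_sdiff]⟩
  choose K hK hμK using hK
  have h0 : μ (⋃ n, K n)ᶜ = 0 := by
    refine le_antisymm (ENNReal.le_of_forall_pos_le_add fun ε hε _ => ?_) zero_le
    obtain ⟨n, hn⟩ := ENNReal.exists_inv_nat_lt (a := ε) (by simpa using hε.ne')
    rw [zero_add]
    calc μ (⋃ n, K n)ᶜ ≤ μ (K n)ᶜ := measure_mono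
          (Set.compl_subset_compl.2 (Set.subset_iUnion K n))
      _ ≤ ((n : ENNReal) + 1)⁻¹ := (hμK n).le
      _ ≤ (n : ENNReal)⁻¹ := ENNReal.inv_le_inv.2 le_self_add
      _ ≤ ε := hn.le
  have hrest : μ.restrict (⋃ n, K n) = μ :=
    Measure.restrict_eq_self_of_ae_mem (mem_ae_iff.2 h0)
  rw [← hrest, aestronglyMeasurable_iUnion_iff]
  exact fun n => hF.continuousOn.aestronglyMeasurable_of_isCompact (hK n) (hK n).measurableSet

namespace ConvFix

/-! ### Weakly continuous maps into normed spaces -/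

section Weak
variable {X : Type*} [NormedAddCommGroup X] [NormedSpace ℂ X]

/-- One splitting step of the Cantor scheme in `exists_isOpen_norm_sub_le`. -/
theorem exists_separated_open_pair {Y : Type*} [TopologicalSpace Y] [LocallyCompactSpace Y]
    [T2Space Y] {F : Y → X} (hF : ∀ Λ : StrongDual ℂ X, Continuous fun y => Λ (F y)) {ε : ℝ}
    {U : Set Y} (hU : IsOpen U) {u v : Y} (hu : u ∈ U) (hv : v ∈ U) (huv : ε < ‖F u - F v‖) :
    ∃ V : Bool → Set Y, (∀ b, IsOpen (V b) ∧ (V b).Nonempty ∧ closure (V b) ⊆ U ∧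
      IsCompact (closure (V b))) ∧ ∀ x ∈ V false, ∀ y ∈ V true, ε < ‖F x - F y‖ := by
  obtain ⟨Λ, hΛ1, hΛ⟩ := exists_dual_vector'' ℂ (F u - F v)
  have hO : IsOpen {p : Y × Y | ε < ‖Λ (F p.1) - Λ (F p.2)‖} :=
    isOpen_lt continuous_const
      (((hF Λ).comp continuous_fst).sub ((hF Λ).comp continuous_snd)).norm
  have hmem : (u, v) ∈ {p : Y × Y | ε < ‖Λ (F p.1) - Λ (F p.2)‖} := by
    simp only [Set.mem_ofPred_eq, ← map_sub, hΛ]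
    simpa using huv
  obtain ⟨A, B, hA, hB, huA, hvB, hAB⟩ := isOpen_prod_iff.1 hO u v hmem
  have key : ∀ (x : Y) (A : Set Y), IsOpen A → x ∈ A → x ∈ U → ∃ V : Set Y, IsOpen V ∧ x ∈ V ∧
      closure V ⊆ A ∩ U ∧ IsCompact (closure V) := fun x A hA hxA hxU => by
    obtain ⟨V, hV, hxV, hVA, hVc⟩ := exists_open_between_and_isCompact_closure
      (isCompact_singleton (x := x)) (hA.inter hU) (by simp [hxA, hxU])
    exact ⟨V, hV, by simpa using hxV, hVA, hVc⟩
  obtain ⟨V₀, h0, hu0, hV0, hc0⟩ := key u A hA huA hu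
  obtain ⟨V₁, h1, hv1, hV1, hc1⟩ := key v B hB hvB hv
  refine ⟨fun b => bif b then V₁ else V₀, ?_, ?_⟩
  · rintro (_ | _)
    · exact ⟨h0, ⟨u, hu0⟩, hV0.trans Set.inter_subset_right, hc0⟩
    · exact ⟨h1, ⟨v, hv1⟩, hV1.trans Set.inter_subset_right, hc1⟩
  · intro x hx y hy
    have : (x, y) ∈ A ×ˢ B := ⟨(hV0 (subset_closure hx)).1, (hV1 (subset_closure hy)).1⟩
    have h2 : ε < ‖Λ (F x) - Λ (F y)‖ := hAB this
    rw [← map_sub] at h2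
    refine h2.trans_le ((Λ.le_opNorm _).trans ?_)
    exact mul_le_of_le_one_left (norm_nonneg _) hΛ1

/-- A weakly continuous map on a nonempty locally compact Hausdorff space has arbitrarily small norm
oscillation on some nonempty open set. Otherwise a Cantor scheme of open sets produces uncountably
many points with `ε`-separated images, and these images all lie in the norm closed span of the
countably many images of the base points of the scheme, which is separable. -/
theorem exists_isOpen_norm_sub_le {Y : Type*} [TopologicalSpace Y] [LocallyCompactSpace Y]
    [T2Space Y] [Nonempty Y] {F : Y → X} (hF : ∀ Λ : StrongDual ℂ X, Continuous fun y => Λ (F y))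
    {ε : ℝ} (hε : 0 < ε) :
    ∃ W : Set Y, IsOpen W ∧ W.Nonempty ∧ ∀ x ∈ W, ∀ y ∈ W, ‖F x - F y‖ ≤ ε := by
  by_contra! H
  let P := {U : Set Y // IsOpen U ∧ U.Nonempty}
  have hstep : ∀ U : P, ∃ V : Bool → P, (∀ b, closure (V b).1 ⊆ U.1 ∧ IsCompact (closure (V b).1)) ∧
      ∀ x ∈ (V false).1, ∀ y ∈ (V true).1, ε < ‖F x - F y‖ := by
    rintro ⟨U, hU, hne⟩
    obtain ⟨u, hu, v, hv, huv⟩ := H U hU hne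
    obtain ⟨V, hV, hV'⟩ := exists_separated_open_pair hF hU hu hv huv
    exact ⟨fun b => ⟨V b, (hV b).1, (hV b).2.1⟩, fun b => (hV b).2.2, hV'⟩
  choose N hN hsep using hstep
  -- a branch `β` is followed through its initial segments `PiNat.res β n`, the newest digit first
  let U : List Bool → P := fun l => l.rec ⟨Set.univ, isOpen_univ, Set.univ_nonempty⟩
    (fun b _ V => N V b)
  have hUcons : ∀ b l, U (b :: l) = N (U l) b := fun _ _ => rfl
  choose u hu using fun l => (U l).2.2
  have hanti : ∀ (β : ℕ → Bool) n, (U (PiNat.res β (n + 1))).1 ⊆ (U (PiNat.res β n)).1 := by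
    intro β n
    rw [PiNat.res_succ, hUcons]
    exact subset_closure.trans (hN _ _).1
  have hanti' : ∀ β : ℕ → Bool, Antitone fun n => (U (PiNat.res β n)).1 := fun β =>
    antitone_nat_of_succ_le (hanti β)
  -- the limit point of a branch is a cluster point of the chosen base points, which keeps its image
  -- in the closed span of countably many vectors
  have hx : ∀ β : ℕ → Bool, ∃ x, MapClusterPt x Filter.atTop (fun n => u (PiNat.res β n)) := by
    intro β
    have hc : IsCompact (closure (U (PiNat.res β 1)).1) := by
      rw [PiNat.res_succ, hUcons]; exact (hN _ _).2
    obtain ⟨x, -, hx⟩ := hc.exists_mapClusterPt (f := Filter.atTop)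
      (u := fun n => u (PiNat.res β n)) (by
        refine Filter.tendsto_principal.2 ?_
        filter_upwards [Filter.eventually_ge_atTop 1] with k hk
        exact subset_closure (hanti' β hk (hu _)))
    exact ⟨x, hx⟩
  choose x hx using hx
  have hxU : ∀ β n, x β ∈ (U (PiNat.res β n)).1 := by
    intro β n
    have h1 : x β ∈ closure (U (PiNat.res β (n + 1))).1 := by
      rw [mem_closure_iff_clusterPt]
      refine (hx β).clusterPt.mono ?_
      rw [Filter.le_principal_iff, Filter.mem_map]
      filter_upwards [Filter.eventually_ge_atTop (n + 1)] with k hk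
      exact hanti' β hk (hu _)
    rw [PiNat.res_succ, hUcons] at h1
    exact (hN _ _).1 h1
  have hdiff : ∀ β γ : ℕ → Bool, β ≠ γ → ε < ‖F (x β) - F (x γ)‖ := by
    intro β γ hne
    set n := PiNat.firstDiff β γ with hn
    have hres : PiNat.res β n = PiNat.res γ n := PiNat.res_eq_res.2 fun {m} hm =>
      PiNat.apply_eq_of_lt_firstDiff hm
    have hb := PiNat.apply_firstDiff_ne hne
    have h1 := hxU β (n + 1)
    have h2 := hxU γ (n + 1)
    rw [PiNat.res_succ, hUcons] at h1 h2
    rw [← hres] at h2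
    rw [← hn] at hb
    rcases hβ : β n with _ | _ <;> rcases hγ : γ n with _ | _
    · simp [hβ, hγ] at hb
    · rw [hβ] at h1; rw [hγ] at h2
      exact hsep _ _ h1 _ h2
    · rw [hβ] at h1; rw [hγ] at h2
      rw [norm_sub_rev]
      exact hsep _ _ h2 _ h1
    · simp [hβ, hγ] at hb
  set S : Set X := closure (Submodule.span ℂ (Set.range fun l => F (u l)) : Set X) with hS
  have hSsep : TopologicalSpace.IsSeparable S :=
    ((Set.countable_range _).isSeparable.span).closure
  have hFS : ∀ β, F (x β) ∈ S := by
    intro β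
    by_contra hnot
    have hconv : Convex ℝ S :=
      ((Submodule.span ℂ (Set.range fun l => F (u l))).restrictScalars ℝ).convex.closure
    obtain ⟨Λ, c, hΛ, hc⟩ := RCLike.geometric_hahn_banach_closed_point (𝕜 := ℂ) hconv
      isClosed_closure hnot
    have hcl : IsClosed {y | (Λ (F y)).re ≤ c} :=
      isClosed_le (Complex.continuous_re.comp (hF Λ)) continuous_const
    have : x β ∈ {y | (Λ (F y)).re ≤ c} := by
      rw [← hcl.closure_eq, mem_closure_iff_clusterPt]
      refine (hx β).clusterPt.mono ?_
      rw [Filter.le_principal_iff, Filter.mem_map]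
      refine Filter.Eventually.of_forall fun k => ?_
      exact (hΛ _ (subset_closure (Submodule.subset_span ⟨_, rfl⟩))).le
    exact absurd hc (not_lt.2 this)
  obtain ⟨C, hC, hSC⟩ := hSsep
  have hd : ∀ β, ∃ d : C, dist (F (x β)) d.1 < ε / 2 := by
    intro β
    obtain ⟨d, hd, hd'⟩ := Metric.mem_closure_iff.1 (hSC (hFS β)) (ε / 2) (half_pos hε)
    exact ⟨⟨d, hd⟩, hd'⟩
  choose d hd using hd
  have hinj : Function.Injective d := by
    intro β γ h
    by_contra hne
    have h1 := hd β
    have h2 := hd γ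
    rw [← h] at h2
    have := hdiff β γ hne
    rw [← dist_eq_norm] at this
    linarith [dist_triangle_right (F (x β)) (F (x γ)) (d β).1]
  have := hC.to_subtype
  have : Countable (ℕ → Bool) := hinj.countable
  obtain ⟨g, hg⟩ := exists_surjective_nat (ℕ → Bool)
  obtain ⟨n, hn⟩ := hg fun n => !(g n n)
  simpa using congrFun hn n

/-- Dentability of weakly compact sets: the image of a bounded weakly continuous map on a compact
space has slices of arbitrarily small diameter. A minimal closed set `Z` on which the real part of
every functional attains its supremum over the whole space contains a relatively open part of small
diameter; by minimality some functional is strictly larger there than on the rest of `Z`, and a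
slice close to the maximum of that functional is concentrated near this part. -/
theorem exists_small_slice {Y : Type*} [TopologicalSpace Y] [CompactSpace Y] [T2Space Y]
    [Nonempty Y] {F : Y → X} (hF : ∀ Λ : StrongDual ℂ X, Continuous fun y => Λ (F y)) {C : ℝ}
    (hC : ∀ y, ‖F y‖ ≤ C) {ε : ℝ} (hε : 0 < ε) :
    ∃ (Λ : StrongDual ℂ X) (w : X) (δ : ℝ) (y₀ : Y), 0 < δ ∧
      (∀ y, (Λ (F y)).re ≤ (Λ (F y₀)).re) ∧
      ∀ y, (Λ (F y₀)).re - δ < (Λ (F y)).re → ‖F y - w‖ ≤ ε := by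
  have hFre : ∀ Λ : StrongDual ℂ X, Continuous fun y => (Λ (F y)).re := fun Λ =>
    Complex.continuous_re.comp (hF Λ)
  -- closed sets on which the real part of every functional is as large as on all of `Y`
  let 𝒵 : Set (Set Y) :=
    {Z | IsClosed Z ∧ ∀ (Λ : StrongDual ℂ X) (y : Y), ∃ z ∈ Z, (Λ (F y)).re ≤ (Λ (F z)).re}
  obtain ⟨Z, hZmin⟩ : ∃ Z, Minimal (· ∈ 𝒵) Z := by
    refine zorn_superset 𝒵 fun c hc hchain => ?_
    rcases c.eq_empty_or_nonempty with rfl | hne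
    · exact ⟨Set.univ, ⟨isClosed_univ, fun Λ y => ⟨y, trivial, le_rfl⟩⟩, by simp⟩
    refine ⟨⋂₀ c, ⟨isClosed_sInter fun Z hZ => (hc hZ).1, fun Λ y => ?_⟩,
      fun Z hZ => Set.sInter_subset_of_mem hZ⟩
    have hT : IsClosed {z | (Λ (F y)).re ≤ (Λ (F z)).re} :=
      isClosed_le continuous_const (hFre Λ)
    have := hne.to_subtype
    obtain ⟨z, hz⟩ := IsCompact.nonempty_iInter_of_directed_nonempty_isCompact_isClosed
      (fun Z : c => (Z : Set Y) ∩ {z | (Λ (F y)).re ≤ (Λ (F z)).re})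
      (by
        rintro ⟨Z₁, h₁⟩ ⟨Z₂, h₂⟩
        rcases hchain.total h₁ h₂ with h | h
        · exact ⟨⟨Z₁, h₁⟩, subset_rfl, Set.inter_subset_inter_left _ h⟩
        · exact ⟨⟨Z₂, h₂⟩, Set.inter_subset_inter_left _ h, subset_rfl⟩)
      (fun Z => by
        obtain ⟨z, hz, hz'⟩ := (hc Z.2).2 Λ y
        exact ⟨z, hz, hz'⟩)
      (fun Z => ((hc Z.2).1.inter hT).isCompact)
      (fun Z => (hc Z.2).1.inter hT)
    rw [Set.mem_iInter] at hz
    exact ⟨z, fun Z hZ => (hz ⟨Z, hZ⟩).1, (hz (Classical.arbitrary c)).2⟩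
  obtain ⟨⟨hZcl, hZ⟩, hmin⟩ := hZmin
  have hZne : Z.Nonempty := by
    obtain ⟨z, hz, -⟩ := hZ 0 (Classical.arbitrary Y)
    exact ⟨z, hz⟩
  have : CompactSpace Z := isCompact_iff_compactSpace.1 hZcl.isCompact
  have := hZne.to_subtype
  obtain ⟨W, hW, ⟨w₀, hw₀⟩, hWε⟩ := exists_isOpen_norm_sub_le (Y := Z) (F := fun z => F z)
    (fun Λ => (hF Λ).comp continuous_subtype_val) (half_pos hε)
  obtain ⟨O, hO, rfl⟩ := isOpen_induced_iff.1 hW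
  obtain ⟨Λ, y₁, hy₁⟩ : ∃ (Λ : StrongDual ℂ X) (y : Y), ∀ z ∈ Z \ O,
      (Λ (F z)).re < (Λ (F y)).re := by
    by_contra! H
    have hmem : Z \ O ∈ 𝒵 := ⟨hZcl.sdiff hO, H⟩
    exact (hmin hmem Set.sdiff_subset w₀.2).2 hw₀
  obtain ⟨z₀, hz₀, hmax⟩ := hZcl.isCompact.exists_isMaxOn hZne (hFre Λ).continuousOn
  have hmaxY : ∀ y, (Λ (F y)).re ≤ (Λ (F z₀)).re := fun y => by
    obtain ⟨z, hz, hyz⟩ := hZ Λ y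
    exact hyz.trans (hmax hz)
  set M := (Λ (F z₀)).re with hM
  have hz₀O : z₀ ∈ O := by
    by_contra h
    exact absurd (hmaxY y₁) (not_le.2 (hy₁ z₀ ⟨hz₀, h⟩))
  -- `Λ` stays below some `m < M` on the part of `Z` outside `O`
  obtain ⟨m, hmM, hm⟩ : ∃ m < M, ∀ z ∈ Z \ O, (Λ (F z)).re ≤ m := by
    rcases (Z \ O).eq_empty_or_nonempty with h | h
    · exact ⟨M - 1, by linarith, by simp [h]⟩
    · obtain ⟨z₁, hz₁, hmax₁⟩ := (hZcl.sdiff hO).isCompact.exists_isMaxOn h (hFre Λ).continuousOn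
      exact ⟨_, (hy₁ z₁ hz₁).trans_le (hmaxY y₁), fun z hz => hmax₁ hz⟩
  have hC0 : 0 ≤ C := (norm_nonneg _).trans (hC z₀)
  set κ := 2 * C / (M - m) with hκ
  have hκ0 : 0 ≤ κ := div_nonneg (by linarith) (by linarith)
  -- `T` is closed and convex, so it contains every `F y` as soon as it contains `F z` for `z ∈ Z`;
  -- the slope `κ` makes the bound trivial for `z ∉ O`
  set T : Set X := {x | ‖x - F z₀‖ + κ * (Λ x).re ≤ ε / 2 + κ * M} with hT
  have hTcl : IsClosed T := isClosed_le (by fun_prop) continuous_const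
  have hTconv : Convex ℝ T := by
    have h1 : ConvexOn ℝ Set.univ fun x : X => ‖x - F z₀‖ := by
      simpa [dist_eq_norm] using convexOn_univ_dist (F z₀)
    have h2 : ConvexOn ℝ Set.univ fun x : X => κ * (Λ x).re := by
      refine ⟨convex_univ, fun x _ y _ a b _ _ _ => le_of_eq ?_⟩
      rw [← Complex.coe_smul a x, ← Complex.coe_smul b y]
      simp
      ring
    have := (h1.add h2).convex_le (ε / 2 + κ * M)
    simpa [hT] using this
  have hZT : ∀ z ∈ Z, F z ∈ T := by
    intro z hz
    by_cases hzO : z ∈ O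
    · have h1 : ‖F z - F z₀‖ ≤ ε / 2 := hWε ⟨z, hz⟩ hzO ⟨z₀, hz₀⟩ hz₀O
      have h2 := mul_le_mul_of_nonneg_left (hmaxY z) hκ0
      change ‖F z - F z₀‖ + κ * (Λ (F z)).re ≤ ε / 2 + κ * M
      linarith
    · have h1 : ‖F z - F z₀‖ ≤ 2 * C := (norm_sub_le _ _).trans (by linarith [hC z, hC z₀])
      have h2 := mul_le_mul_of_nonneg_left (hm z ⟨hz, hzO⟩) hκ0
      have h3 : κ * (M - m) = 2 * C := by
        rw [hκ]; field_simp [(sub_pos.2 hmM).ne']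
      have h4 : κ * m = κ * M - 2 * C := by rw [← h3]; ring
      change ‖F z - F z₀‖ + κ * (Λ (F z)).re ≤ ε / 2 + κ * M
      linarith
  have hYT : ∀ y, F y ∈ T := by
    intro y
    by_contra h
    obtain ⟨Λ', c, hΛ', hc⟩ := RCLike.geometric_hahn_banach_closed_point (𝕜 := ℂ) hTconv hTcl h
    obtain ⟨z, hz, hyz⟩ := hZ Λ' y
    exact absurd (hΛ' _ (hZT z hz)) (not_lt.2 (hc.le.trans hyz))
  refine ⟨Λ, F z₀, ε / 2 / (κ + 1), z₀, by positivity, hmaxY, fun y hy => ?_⟩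
  have h1 : ‖F y - F z₀‖ + κ * (Λ (F y)).re ≤ ε / 2 + κ * M := hYT y
  have h2 := mul_le_mul_of_nonneg_left hy.le hκ0
  have h3 : κ * (ε / 2 / (κ + 1)) ≤ ε / 2 := by
    rw [mul_div_assoc', div_le_iff₀ (by positivity)]
    nlinarith
  rw [mul_sub] at h2
  linarith

theorem continuous_dual_toWeakSpace_symm (Λ : StrongDual ℂ X) :
    Continuous fun x : WeakSpace ℂ X => Λ ((toWeakSpace ℂ X).symm x) :=
  WeakBilin.eval_continuous _ Λ

end Weak

/-! ### Left translation and weakly almost periodic functions -/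

section Translate
variable {G : Type*} [Group G] [TopologicalSpace G] [IsTopologicalGroup G]

@[simp]
theorem leftTranslate_apply (s : G) (f : G →ᵇ ℂ) (t : G) : leftTranslate s f t = f (s * t) := rfl

theorem leftTranslate_leftTranslate (u s : G) (f : G →ᵇ ℂ) :
    leftTranslate u (leftTranslate s f) = leftTranslate (s * u) f := by
  ext t; simp [mul_assoc]

theorem norm_leftTranslate_le (s : G) (f : G →ᵇ ℂ) : ‖leftTranslate s f‖ ≤ ‖f‖ :=
  (norm_le (norm_nonneg _)).2 fun t => f.norm_coe_le_norm (s * t)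

/-- The left translation `ℓ_s` as a continuous linear operator. -/
noncomputable def leftTranslateL (s : G) : (G →ᵇ ℂ) →L[ℂ] (G →ᵇ ℂ) :=
  LinearMap.mkContinuous
    { toFun := leftTranslate s
      map_add' := fun _ _ => rfl
      map_smul' := fun _ _ => rfl } 1 fun f => by
      rw [one_mul]; exact norm_leftTranslate_le s f

@[simp]
theorem leftTranslateL_apply (s : G) (f : G →ᵇ ℂ) : leftTranslateL s f = leftTranslate s f := rfl

/-- The weak closure of the orbit of `f` under left translation. -/
def weakOrbit (f : G →ᵇ ℂ) : Set (WeakSpace ℂ (G →ᵇ ℂ)) :=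
  closure (toWeakSpace ℂ (G →ᵇ ℂ) '' Set.range fun s : G => leftTranslate s f)

theorem leftTranslate_mem_weakOrbit (s : G) (f : G →ᵇ ℂ) :
    toWeakSpace ℂ _ (leftTranslate s f) ∈ weakOrbit f :=
  subset_closure ⟨_, ⟨s, rfl⟩, rfl⟩

/-- The orbit map of a function in `WAP(G)` is weakly continuous, because on the weakly compact
orbit closure the weak topology is the topology of pointwise convergence. -/
theorem continuous_dual_leftTranslate {f : G →ᵇ ℂ} (hf : f ∈ WAP G)
    (Λ : StrongDual ℂ (G →ᵇ ℂ)) : Continuous fun s : G => Λ (leftTranslate s f) := by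
  have : CompactSpace (weakOrbit f) := isCompact_iff_compactSpace.1 hf
  let e : weakOrbit f → G → ℂ := fun q t => (toWeakSpace ℂ (G →ᵇ ℂ)).symm q.1 t
  have he : Continuous e := continuous_pi fun t =>
    (continuous_dual_toWeakSpace_symm (evalCLM ℂ t)).comp continuous_subtype_val
  have hinj : Function.Injective e := fun p q h => by
    apply Subtype.ext
    apply (toWeakSpace ℂ (G →ᵇ ℂ)).symm.injective
    ext t
    exact congrFun h t
  have hemb := (he.isClosedEmbedding hinj).isEmbedding
  let o : G → weakOrbit f := fun s => ⟨_, leftTranslate_mem_weakOrbit s f⟩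
  have ho : Continuous o := by
    rw [hemb.continuous_iff]
    refine continuous_pi fun t => ?_
    exact f.continuous.comp (continuous_mul_const t)
  exact ((continuous_dual_toWeakSpace_symm Λ).comp continuous_subtype_val).comp ho

/-- Small oscillation of the orbit map on one open set spreads to every point, since
`‖ℓ_{us} f - ℓ_{vs} f‖ = ‖ℓ_u f - ℓ_v f‖`. -/
theorem WAP_subset_LUC [LocallyCompactSpace G] [T2Space G] : WAP G ⊆ LUC G := by
  intro f hf
  refine continuous_iff_continuousAt.2 fun s₀ => Metric.continuousAt_iff'.2 fun ε hε => ?_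
  obtain ⟨W, hW, ⟨w, hw⟩, hWε⟩ := exists_isOpen_norm_sub_le (F := fun s : G => leftTranslate s f)
    (continuous_dual_leftTranslate hf) (half_pos hε)
  have hmem : ∀ᶠ s in 𝓝 s₀, s * (s₀⁻¹ * w) ∈ W := by
    refine (continuous_mul_const (s₀⁻¹ * w)).continuousAt.eventually_mem ?_
    simpa using hW.mem_nhds hw
  filter_upwards [hmem] with s hs
  rw [dist_eq_norm]
  have h1 : leftTranslate s f - leftTranslate s₀ f =
      leftTranslate (w⁻¹ * s₀) (leftTranslate (s * (s₀⁻¹ * w)) f - leftTranslate w f) := by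
    rw [← leftTranslateL_apply (w⁻¹ * s₀), map_sub, leftTranslateL_apply, leftTranslateL_apply,
      leftTranslate_leftTranslate, leftTranslate_leftTranslate]
    simp [mul_assoc]
  rw [h1]
  linarith [norm_leftTranslate_le (w⁻¹ * s₀)
    (leftTranslate (s * (s₀⁻¹ * w)) f - leftTranslate w f), hWε _ hs _ hw]

/-! ### Rigidity of weakly almost periodic fixed points -/

variable [T2Space G] [MeasurableSpace G] [BorelSpace G] {μ : Measure G} {h : G → ℂ}

theorem integrable_smul_leftTranslate [IsFiniteMeasure μ] [μ.Regular] (hm : Measurable h)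
    (h1 : ∀ x, ‖h x‖ = 1) {f : G →ᵇ ℂ} (hf : f ∈ LUC G) :
    Integrable (fun s => h s • leftTranslate s f) μ := by
  have hF : AEStronglyMeasurable (fun s => leftTranslate s f) μ :=
    Continuous.aestronglyMeasurable_of_regular hf
  refine Integrable.of_bound (hm.aestronglyMeasurable.smul hF) ‖f‖ ?_
  filter_upwards with s
  rw [norm_smul, h1, one_mul]
  exact norm_leftTranslate_le s f

/-- A fixed point in `LUC(G)` is the barycentre of its own translates, twisted by `h`, as a Bochner
integral in the space of bounded continuous functions. -/
theorem integral_smul_leftTranslate_eq [IsFiniteMeasure μ] [μ.Regular] (hm : Measurable h)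
    (h1 : ∀ x, ‖h x‖ = 1) {f : G →ᵇ ℂ} (hf : f ∈ LUC G)
    (hfix : ∀ t, ∫ s, f (s * t) * h s ∂μ = f t) :
    ∫ s, h s • leftTranslate s f ∂μ = f := by
  ext t
  have := (evalCLM ℂ t).integral_comp_comm (integrable_smul_leftTranslate (μ := μ) hm h1 hf)
  change _ = (∫ s, h s • leftTranslate s f ∂μ) t at this
  rw [← this, ← hfix t]
  refine integral_congr_ae (Filter.Eventually.of_forall fun s => ?_)
  change h s * f (s * t) = _
  ring

/-- A fixed point in `WAP(G)` equals almost all of its twisted translates. If `c ℓ_u f` lies deep in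
a slice of small diameter of the orbit closure, then so do most of the `c h(s) ℓ_u ℓ_s f`, of which
it is the barycentre; as `c ℓ_u` is isometric, `h(s) ℓ_s f` is close to `f`. -/
theorem ae_smul_leftTranslate_eq_of_WAP [LocallyCompactSpace G] [IsProbabilityMeasure μ]
    [μ.Regular] (hm : Measurable h)
    (h1 : ∀ x, ‖h x‖ = 1) {f : G →ᵇ ℂ} (hf : f ∈ WAP G)
    (hfix : ∀ t, ∫ s, f (s * t) * h s ∂μ = f t) :
    ∀ᵐ s ∂μ, h s • leftTranslate s f = f := by
  have hint := integrable_smul_leftTranslate (μ := μ) hm h1 (WAP_subset_LUC hf)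
  have hbary := integral_smul_leftTranslate_eq (μ := μ) hm h1 (WAP_subset_LUC hf) hfix
  have : CompactSpace (weakOrbit f) := isCompact_iff_compactSpace.1 hf
  let o : G → weakOrbit f := fun s => ⟨_, leftTranslate_mem_weakOrbit s f⟩
  have : Nonempty (weakOrbit f) := ⟨o 1⟩
  -- unimodular multiples of the orbit closure, still parametrized by a compact space
  let F : Circle × weakOrbit f → (G →ᵇ ℂ) := fun y =>
    (y.1 : ℂ) • (toWeakSpace ℂ (G →ᵇ ℂ)).symm y.2.1
  have hF : ∀ Λ : StrongDual ℂ (G →ᵇ ℂ), Continuous fun y => Λ (F y) := fun Λ => by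
    simp only [F, map_smul, smul_eq_mul]
    exact ((continuous_subtype_val : Continuous fun c : Circle => (c : ℂ)).comp continuous_fst).mul
      (((continuous_dual_toWeakSpace_symm Λ).comp continuous_subtype_val).comp continuous_snd)
  have hbound : ∀ y, ‖F y‖ ≤ ‖f‖ := by
    rintro ⟨c, q, hq⟩
    have hcl : IsClosed {x : WeakSpace ℂ (G →ᵇ ℂ) |
        ∀ t, ‖(toWeakSpace ℂ (G →ᵇ ℂ)).symm x t‖ ≤ ‖f‖} := by
      simp only [Set.ofPred_forall]
      exact isClosed_iInter fun t =>
        isClosed_le (continuous_dual_toWeakSpace_symm (evalCLM ℂ t)).norm continuous_const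
    have hsub : weakOrbit f ⊆ {x : WeakSpace ℂ (G →ᵇ ℂ) |
        ∀ t, ‖(toWeakSpace ℂ (G →ᵇ ℂ)).symm x t‖ ≤ ‖f‖} := by
      refine closure_minimal ?_ hcl
      rintro _ ⟨_, ⟨s, rfl⟩, rfl⟩ t
      exact f.norm_coe_le_norm (s * t)
    simp only [F, norm_smul, Circle.norm_coe, one_mul]
    exact (norm_le (norm_nonneg _)).2 (hsub hq)
  have key : ∀ ε > 0, ∀ᵐ s ∂μ, ‖h s • leftTranslate s f - f‖ ≤ 2 * ε := by
    intro ε hε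
    obtain ⟨Λ, w, δ, ⟨c₀, q₀⟩, hδ, hmax, hslice⟩ := exists_small_slice hF hbound hε
    set M := (Λ (F (c₀, q₀))).re with hM
    by_contra hA
    rw [ae_iff] at hA
    set A := {s | ¬ ‖h s • leftTranslate s f - f‖ ≤ 2 * ε} with hAdef
    have hα : 0 < μ.real A := ENNReal.toReal_pos hA (measure_ne_top _ _)
    have hα1 : μ.real A ≤ 1 := measureReal_le_one
    -- the depth `μ(A) δ` in the slice is what Markov's inequality needs to reach a point of `A`
    obtain ⟨u, hu⟩ : ∃ u : G, M - μ.real A * δ < (Λ ((c₀ : ℂ) • leftTranslate u f)).re := by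
      have hopen : IsOpen {x : WeakSpace ℂ (G →ᵇ ℂ) | M - μ.real A * δ <
          (((c₀ : ℂ) • Λ) ((toWeakSpace ℂ (G →ᵇ ℂ)).symm x)).re} :=
        isOpen_lt continuous_const
          (Complex.continuous_re.comp (continuous_dual_toWeakSpace_symm _))
      have hq : q₀.1 ∈ {x : WeakSpace ℂ (G →ᵇ ℂ) | M - μ.real A * δ <
          (((c₀ : ℂ) • Λ) ((toWeakSpace ℂ (G →ᵇ ℂ)).symm x)).re} := by
        have : (((c₀ : ℂ) • Λ) ((toWeakSpace ℂ (G →ᵇ ℂ)).symm q₀.1)).re = M := by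
          simp only [hM, F, map_smul]; rfl
        simp only [Set.mem_ofPred_eq, this]
        have := mul_pos hα hδ
        linarith
      obtain ⟨_, hx, ⟨_, ⟨u, rfl⟩, rfl⟩⟩ := mem_closure_iff.1 q₀.2 _ hopen hq
      refine ⟨u, ?_⟩
      rw [map_smul]
      exact hx
    let Ψ : (G →ᵇ ℂ) →L[ℂ] ℂ := Λ.comp ((c₀ : ℂ) • leftTranslateL u)
    have hΨ : ∀ g, Ψ g = Λ ((c₀ : ℂ) • leftTranslate u g) := fun _ => rfl
    let d : G → Circle := fun s => ⟨h s, mem_sphere_zero_iff_norm.2 (h1 s)⟩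
    have hd : ∀ s, (c₀ : ℂ) • leftTranslate u (h s • leftTranslate s f)
        = F (c₀ * d s, o (s * u)) := by
      intro s
      have : leftTranslate u (h s • leftTranslate s f) = h s • leftTranslate (s * u) f := by
        rw [← leftTranslate_leftTranslate]; rfl
      rw [this, smul_smul]
      simp only [F, Circle.coe_mul]
      rfl
    have hk0 : ∀ s, 0 ≤ M - (Ψ (h s • leftTranslate s f)).re := fun s => by
      rw [hΨ, hd]; exact sub_nonneg.2 (hmax _)
    have hΨint : Integrable (fun s => (Ψ (h s • leftTranslate s f)).re) μ :=
      (Ψ.integrable_comp hint).re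
    have hkint : Integrable (fun s => M - (Ψ (h s • leftTranslate s f)).re) μ :=
      (integrable_const M).sub hΨint
    have hI : ∫ s, (M - (Ψ (h s • leftTranslate s f)).re) ∂μ = M - (Ψ f).re := by
      rw [integral_sub (integrable_const M) hΨint]
      have h2 : ∫ s, (Ψ (h s • leftTranslate s f)).re ∂μ
          = (∫ s, Ψ (h s • leftTranslate s f) ∂μ).re :=
        integral_re (𝕜 := ℂ) (Ψ.integrable_comp hint)
      rw [h2, Ψ.integral_comp_comm hint, hbary]
      simp
    have hmarkov := mul_meas_ge_le_integral_of_nonneg (Filter.Eventually.of_forall hk0) hkint δ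
    rw [hI] at hmarkov
    have hAsub : A ⊆ {s | δ ≤ M - (Ψ (h s • leftTranslate s f)).re} := by
      intro s hs
      by_contra hlt
      simp only [Set.mem_ofPred_eq, not_le] at hlt
      apply hs
      have e1 : ‖F (c₀ * d s, o (s * u)) - w‖ ≤ ε := by
        apply hslice
        rw [← hd, ← hΨ]; linarith
      have e2 : ‖F (c₀, o u) - w‖ ≤ ε := by
        apply hslice
        have : (Λ (F (c₀, o u))).re = (Λ ((c₀ : ℂ) • leftTranslate u f)).re := rfl
        rw [this]
        nlinarith
      have e3 : F (c₀ * d s, o (s * u)) - F (c₀, o u)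
          = (c₀ : ℂ) • leftTranslate u (h s • leftTranslate s f - f) := by
        rw [← hd]
        change _ - (c₀ : ℂ) • leftTranslate u f = _
        rw [← smul_sub]; rfl
      have e4 : ∀ g : G →ᵇ ℂ, ‖g‖ ≤ ‖(c₀ : ℂ) • leftTranslate u g‖ := fun g => by
        rw [norm_smul, Circle.norm_coe, one_mul]
        have : g = leftTranslate u⁻¹ (leftTranslate u g) := by
          rw [leftTranslate_leftTranslate]; ext t; simp
        conv_lhs => rw [this]
        exact norm_leftTranslate_le _ _
      refine (e4 _).trans ?_
      rw [← e3, ← sub_sub_sub_cancel_right _ _ w]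
      exact (norm_sub_le _ _).trans (by linarith)
    have h3 : μ.real A ≤ μ.real {s | δ ≤ M - (Ψ (h s • leftTranslate s f)).re} :=
      measureReal_mono hAsub
    have h4 := mul_le_mul_of_nonneg_left h3 hδ.le
    rw [hΨ] at hmarkov
    linarith
  have h2 : ∀ᵐ s ∂μ, ∀ n : ℕ, ‖h s • leftTranslate s f - f‖ ≤ 2 * (1 / ((n : ℝ) + 1)) :=
    ae_all_iff.2 fun n => key _ Nat.one_div_pos_of_nat
  filter_upwards [h2] with s hs
  rw [← sub_eq_zero, ← norm_le_zero_iff]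
  have := (tendsto_one_div_add_atTop_nhds_zero_nat (𝕜 := ℝ)).const_mul 2
  rw [mul_zero] at this
  exact ge_of_tendsto' this hs

end Translate

/-! ### The Choquet–Deny argument on abelian groups -/

section ChoquetDeny
variable {G : Type*} [Group G] [TopologicalSpace G] [IsTopologicalGroup G]

theorem mul_star_mem_LUC {g : G →ᵇ ℂ} (hg : g ∈ LUC G) : g * star g ∈ LUC G := by
  have hg' : Continuous fun s : G => leftTranslate s g := hg
  exact hg'.mul hg'.star

variable [MeasurableSpace G] [BorelSpace G]

theorem integrable_translate (μ : Measure G) [IsFiniteMeasure μ] (t : G) (g : G →ᵇ ℂ) :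
    Integrable (fun s => g (s * t)) μ :=
  Integrable.of_bound (g.continuous.comp (continuous_mul_const t)).aestronglyMeasurable ‖g‖
    (Filter.Eventually.of_forall fun _ => g.norm_coe_le_norm _)

/-- The functional `g ↦ ∫ g(st) dμ(s)` on bounded continuous functions. -/
noncomputable def avgAt (μ : Measure G) [IsProbabilityMeasure μ] (t : G) : (G →ᵇ ℂ) →L[ℂ] ℂ :=
  LinearMap.mkContinuous
    { toFun := fun g => ∫ s, g (s * t) ∂μ
      map_add' := fun g k => integral_add (integrable_translate μ t g) (integrable_translate μ t k)
      map_smul' := fun c g => integral_const_mul c _ } 1 fun g => by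
    rw [one_mul]
    refine (norm_integral_le_of_norm_le_const (C := ‖g‖)
      (Filter.Eventually.of_forall fun s => g.norm_coe_le_norm (s * t))).trans ?_
    simp

variable {μ : Measure G} [IsProbabilityMeasure μ]

theorem avgAt_apply (t : G) (g : G →ᵇ ℂ) : avgAt μ t g = ∫ s, g (s * t) ∂μ := rfl

theorem norm_avgAt_le (t : G) (g : G →ᵇ ℂ) : ‖avgAt μ t g‖ ≤ ‖g‖ := by
  refine (norm_integral_le_of_norm_le_const (C := ‖g‖)
    (Filter.Eventually.of_forall fun s => g.norm_coe_le_norm (s * t))).trans ?_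
  simp

/-- The average `∫ ℓ_s g dμ(s)`. -/
noncomputable def avg (μ : Measure G) (g : G →ᵇ ℂ) : G →ᵇ ℂ := ∫ s, leftTranslate s g ∂μ

variable {h : G → ℂ}

/-- The variance identity: the defect in Jensen's inequality for `|g|²` at a fixed point `g`. -/
theorem avgAt_mul_star_sub (hm : Measurable h) (h1 : ∀ x, ‖h x‖ = 1) {g : G →ᵇ ℂ} {t : G}
    (hg : ∫ s, g (s * t) * h s ∂μ = g t) :
    avgAt μ t (g * star g) - (g * star g) t = ((∫ s, ‖h s * g (s * t) - g t‖ ^ 2 ∂μ : ℝ) : ℂ) := by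
  have hgt := integrable_translate μ t g
  have hgh : Integrable (fun s => g (s * t) * h s) μ :=
    hgt.mul_bdd (c := 1) hm.aestronglyMeasurable (by simp [h1])
  have hgg : Integrable (fun s => (g * star g) (s * t)) μ := integrable_translate μ t _
  have hgc : Integrable (fun s => starRingEnd ℂ (g (s * t) * h s)) μ :=
    (Complex.conjCLE.toContinuousLinearMap.integrable_comp hgh :)
  have hpt : ∀ s, ((‖h s * g (s * t) - g t‖ ^ 2 : ℝ) : ℂ) = (g * star g) (s * t)
      - (g (s * t) * h s) * starRingEnd ℂ (g t) - starRingEnd ℂ (g (s * t) * h s) * g t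
      + g t * starRingEnd ℂ (g t) := by
    intro s
    have hh : h s * starRingEnd ℂ (h s) = 1 := by
      rw [Complex.mul_conj, Complex.normSq_eq_norm_sq, h1]; simp
    rw [← Complex.normSq_eq_norm_sq, ← Complex.mul_conj]
    simp only [map_sub, map_mul, coe_mul, Pi.mul_apply, star_apply]
    change _ = g (s * t) * starRingEnd ℂ (g (s * t)) - _ - _ + _
    linear_combination g (s * t) * starRingEnd ℂ (g (s * t)) * hh
  rw [← integral_complex_ofReal]
  simp_rw [hpt]
  rw [integral_add, integral_sub, integral_sub, integral_mul_const, integral_mul_const,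
    integral_conj, hg, avgAt_apply]
  · simp only [integral_const, probReal_univ, one_smul]
    change _ - g t * starRingEnd ℂ (g t) = _
    ring
  · exact hgg
  · exact hgh.mul_const _
  · exact hgg.sub (hgh.mul_const _)
  · exact hgc.mul_const _
  · exact (hgg.sub (hgh.mul_const _)).sub (hgc.mul_const _)
  · exact integrable_const _

variable [T2Space G] [μ.Regular]

theorem integrable_leftTranslate {g : G →ᵇ ℂ} (hg : g ∈ LUC G) :
    Integrable (fun s => leftTranslate s g) μ := by
  simpa using integrable_smul_leftTranslate (μ := μ) (h := fun _ => 1) measurable_const (by simp) hg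

theorem avg_apply {g : G →ᵇ ℂ} (hg : g ∈ LUC G) (t : G) : avg μ g t = avgAt μ t g :=
  ((evalCLM ℂ t).integral_comp_comm (integrable_leftTranslate (μ := μ) hg)).symm

theorem avg_mem_LUC (hcomm : ∀ a b : G, a * b = b * a) {g : G →ᵇ ℂ} (hg : g ∈ LUC G) :
    avg μ g ∈ LUC G := by
  have hg' : Continuous fun s : G => leftTranslate s g := hg
  have hLUC : ∀ u, leftTranslate u g ∈ LUC G := fun u => by
    change Continuous fun s => leftTranslate s (leftTranslate u g)
    simp_rw [leftTranslate_leftTranslate]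
    exact hg'.comp (continuous_const_mul u)
  have hL : ∀ u, leftTranslate u (avg μ g) = avg μ (leftTranslate u g) := fun u => by
    rw [avg, ← leftTranslateL_apply,
      ← (leftTranslateL u).integral_comp_comm (integrable_leftTranslate (μ := μ) hg), avg]
    congr 1 with s : 1
    rw [leftTranslateL_apply, leftTranslate_leftTranslate, leftTranslate_leftTranslate, hcomm]
  refine continuous_iff_continuousAt.2 fun u => Metric.continuousAt_iff'.2 fun ε hε => ?_
  filter_upwards [Metric.continuousAt_iff'.1 hg'.continuousAt ε hε] with v hv
  refine lt_of_le_of_lt ?_ hv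
  refine (dist_le dist_nonneg).2 fun t => ?_
  rw [hL, hL, avg_apply (hLUC v), avg_apply (hLUC u), dist_eq_norm, dist_eq_norm, ← map_sub]
  exact norm_avgAt_le _ _

/-- The variance `V = ∫ |h(s) ℓ_s f - f|² dμ(s)` of a fixed point is subharmonic, because by
commutativity each `h(s) ℓ_s f - f` is again a fixed point. -/
theorem re_le_re_avgAt_variance (hcomm : ∀ a b : G, a * b = b * a) (hm : Measurable h)
    (h1 : ∀ x, ‖h x‖ = 1) {f : G →ᵇ ℂ} (hf : f ∈ LUC G)
    (hfix : ∀ t, ∫ s, f (s * t) * h s ∂μ = f t) (t : G) :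
    ((avg μ (f * star f) - f * star f) t).re ≤
      (avgAt μ t (avg μ (f * star f) - f * star f)).re := by
  let φ : G → G →ᵇ ℂ := fun s => h s • leftTranslate s f - f
  have hφt : ∀ s t, φ s t = h s * f (s * t) - f t := fun _ _ => rfl
  have hφint : Integrable φ μ := (integrable_smul_leftTranslate hm h1 hf).sub (integrable_const f)
  have hφb : ∀ s, ‖φ s‖ ≤ 2 * ‖f‖ := fun s => by
    refine (norm_sub_le _ _).trans ?_
    rw [norm_smul, h1, one_mul]
    linarith [norm_leftTranslate_le s f]
  have hNint : Integrable (fun s => φ s * star (φ s)) μ := by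
    refine Integrable.of_bound (hφint.aestronglyMeasurable.mul hφint.aestronglyMeasurable.star)
      ((2 * ‖f‖) * (2 * ‖f‖)) (Filter.Eventually.of_forall fun s => ?_)
    refine (norm_mul_le _ _).trans ?_
    rw [norm_star]
    exact mul_le_mul (hφb s) (hφb s) (norm_nonneg _) (by positivity)
  have hNt : ∀ s t, (φ s * star (φ s)) t = ((‖φ s t‖ ^ 2 : ℝ) : ℂ) := fun s t => by
    rw [← Complex.normSq_eq_norm_sq, ← Complex.mul_conj]; rfl
  have hV : avg μ (f * star f) - f * star f = ∫ s, φ s * star (φ s) ∂μ := by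
    ext t
    have := (evalCLM ℂ t).integral_comp_comm hNint
    change _ = (∫ s, φ s * star (φ s) ∂μ) t at this
    rw [← this]
    change avg μ (f * star f) t - (f * star f) t = ∫ s, (φ s * star (φ s)) t ∂μ
    rw [avg_apply (mul_star_mem_LUC hf), avgAt_mul_star_sub hm h1 (hfix t)]
    simp_rw [hNt]
    rw [integral_complex_ofReal]
    rfl
  have hφfix : ∀ s t, ∫ u, φ s (u * t) * h u ∂μ = φ s t := by
    intro s t
    have hgh : ∀ t, Integrable (fun u => f (u * t) * h u) μ := fun t =>
      (integrable_translate μ t f).mul_bdd (c := 1) hm.aestronglyMeasurable (by simp [h1])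
    have : ∀ u, φ s (u * t) * h u = h s * (f (u * (s * t)) * h u) - f (u * t) * h u := fun u => by
      rw [hφt, ← mul_assoc s u t, hcomm s u, mul_assoc u s t]; ring
    simp_rw [this]
    rw [integral_sub ((hgh _).const_mul _) (hgh _), integral_const_mul, hfix, hfix, hφt]
  have hle : ∀ s, ((φ s * star (φ s)) t).re ≤ (avgAt μ t (φ s * star (φ s))).re := by
    intro s
    have := congrArg Complex.re (avgAt_mul_star_sub hm h1 (hφfix s t))
    rw [Complex.sub_re, Complex.ofReal_re] at this
    have h0 : 0 ≤ ∫ u, ‖h u * φ s (u * t) - φ s t‖ ^ 2 ∂μ := integral_nonneg fun _ => by positivity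
    linarith
  have hre : ∀ Λ : (G →ᵇ ℂ) →L[ℂ] ℂ, (Λ (∫ s, φ s * star (φ s) ∂μ)).re =
      ∫ s, (Λ (φ s * star (φ s))).re ∂μ := fun Λ => by
    rw [← Λ.integral_comp_comm hNint]
    exact (integral_re (𝕜 := ℂ) (Λ.integrable_comp hNint)).symm
  rw [hV]
  have e1 := hre (evalCLM ℂ t)
  change ((∫ s, φ s * star (φ s) ∂μ) t).re = _ at e1
  rw [e1, hre]
  exact integral_mono ((evalCLM ℂ t).integrable_comp hNint).re
    ((avgAt μ t).integrable_comp hNint).re hle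

/-- The Choquet–Deny theorem: writing `V` for the variance of `f` and `Pⁿ` for the iterated
averages, `V ≤ Pᵏ V` gives `n V ≤ ∑_{k<n} Pᵏ V = Pⁿ |f|² - |f|²`, which is bounded in `n`, so `V =
0`. -/
theorem ae_mul_eq_of_LUC (hcomm : ∀ a b : G, a * b = b * a) (hm : Measurable h)
    (h1 : ∀ x, ‖h x‖ = 1) {f : G →ᵇ ℂ} (hf : f ∈ LUC G)
    (hfix : ∀ t, ∫ s, f (s * t) * h s ∂μ = f t) (t : G) :
    ∀ᵐ s ∂μ, h s * f (s * t) = f t := by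
  set N := f * star f with hN
  -- the iterated averages of `|f|²`, so that `W 1 - W 0` is the variance
  let W : ℕ → G →ᵇ ℂ := fun n => (avg μ)^[n] N
  have hWs : ∀ n, W (n + 1) = avg μ (W n) := fun n => Function.iterate_succ_apply' _ _ _
  have hW : ∀ n, W n ∈ LUC G := fun n => by
    induction n with
    | zero => exact mul_star_mem_LUC hf
    | succ n ih => rw [hWs]; exact avg_mem_LUC hcomm ih
  have hWt : ∀ n t, W (n + 1) t = avgAt μ t (W n) := fun n t => by rw [hWs, avg_apply (hW n)]
  have hWb : ∀ n, ‖W n‖ ≤ ‖N‖ := fun n => by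
    induction n with
    | zero => exact le_rfl
    | succ n ih =>
      refine (norm_le (norm_nonneg _)).2 fun t => ?_
      rw [hWt]
      exact (norm_avgAt_le t _).trans ih
  have hinc : ∀ n t, ((W 1 - W 0) t).re ≤ ((W (n + 1) - W n) t).re := by
    intro n
    induction n with
    | zero => exact fun _ => le_rfl
    | succ n ih =>
      intro t
      refine (re_le_re_avgAt_variance hcomm hm h1 hf hfix t).trans ?_
      have : (W (n + 1 + 1) - W (n + 1)) t = avgAt μ t (W (n + 1) - W n) := by
        rw [map_sub, ← hWt, ← hWt]; rfl
      rw [this, avgAt_apply, avgAt_apply]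
      have e : ∀ g : G →ᵇ ℂ, (∫ s, g (s * t) ∂μ).re = ∫ s, (g (s * t)).re ∂μ := fun g =>
        (integral_re (𝕜 := ℂ) (integrable_translate μ t g)).symm
      rw [e, e]
      exact integral_mono (integrable_translate μ t (W 1 - W 0)).re
        (integrable_translate μ t (W (n + 1) - W n)).re fun s => ih (s * t)
  have hsum : ∀ n : ℕ, n * ((W 1 - W 0) t).re ≤ 2 * ‖N‖ := by
    intro n
    have h2 : (n : ℝ) * ((W 1 - W 0) t).re ≤ (W n t).re - (W 0 t).re := by
      induction n with
      | zero => simp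
      | succ n ih =>
        have := hinc n t
        simp only [BoundedContinuousFunction.coe_sub, Pi.sub_apply, Complex.sub_re] at this ih ⊢
        push_cast
        linarith
    have h3 := (Complex.abs_re_le_norm (W n t)).trans (((W n).norm_coe_le_norm t).trans (hWb n))
    have h4 := (Complex.abs_re_le_norm (W 0 t)).trans (((W 0).norm_coe_le_norm t).trans (hWb 0))
    linarith [(abs_le.1 h3).2, (abs_le.1 h4).1]
  have hV0 : ((W 1 - W 0) t).re ≤ 0 := by
    by_contra! hpos
    obtain ⟨n, hn⟩ := exists_nat_gt (2 * ‖N‖ / ((W 1 - W 0) t).re)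
    rw [div_lt_iff₀ hpos] at hn
    exact absurd (hsum n) (not_le.2 hn)
  have hV : ((W 1 - W 0) t).re = ∫ s, ‖h s * f (s * t) - f t‖ ^ 2 ∂μ := by
    have := congrArg Complex.re (avgAt_mul_star_sub hm h1 (hfix t))
    rw [Complex.ofReal_re, ← hN] at this
    rw [← this, BoundedContinuousFunction.coe_sub, Pi.sub_apply, hWt]
    rfl
  rw [hV] at hV0
  have hint : Integrable (fun s => ‖h s * f (s * t) - f t‖ ^ 2) μ := by
    refine Integrable.of_bound (((hm.aestronglyMeasurable.mul
      (integrable_translate μ t f).aestronglyMeasurable).sub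
      aestronglyMeasurable_const).norm.pow 2) ((2 * ‖f‖) ^ 2)
      (Filter.Eventually.of_forall fun s => ?_)
    rw [norm_pow, norm_norm]
    gcongr
    refine (norm_sub_le _ _).trans ?_
    rw [norm_mul, h1, one_mul]
    linarith [f.norm_coe_le_norm (s * t), f.norm_coe_le_norm t]
  have h0 := (integral_eq_zero_iff_of_nonneg (fun _ => by positivity) hint).1
    (le_antisymm hV0 (integral_nonneg fun _ => by positivity))
  filter_upwards [h0] with s hs
  simpa [sub_eq_zero] using hs

end ChoquetDeny

/-! ### The common eigencharacter -/

section Character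
variable {G : Type*} [Group G] [TopologicalSpace G] [IsTopologicalGroup G]

/-- The closed subgroup of those `s` whose translation multiplies `f`, and every member of the
family `𝓕`, by the single scalar `f (s * t₀) / f t₀`, which has modulus one. -/
def eigenSubgroup (𝓕 : Set (G →ᵇ ℂ)) {f : G →ᵇ ℂ} (hf : f ∈ 𝓕) {t₀ : G} (h0 : f t₀ ≠ 0) :
    Subgroup G where
  carrier := {s | ‖f (s * t₀)‖ = ‖f t₀‖ ∧ ∀ g ∈ 𝓕, ∀ t, g (s * t) * f t₀ = f (s * t₀) * g t}
  one_mem' := ⟨by simp, fun g _ t => by rw [one_mul, one_mul, mul_comm]⟩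
  mul_mem' := by
    rintro a b ⟨ha, ha'⟩ ⟨hb, hb'⟩
    have hab : f (a * b * t₀) * f t₀ = f (a * t₀) * f (b * t₀) := by
      rw [mul_assoc]; exact ha' f hf _
    refine ⟨?_, fun g hg t => mul_right_cancel₀ h0 ?_⟩
    · have := congrArg norm hab
      rw [norm_mul, norm_mul, ha, hb] at this
      exact mul_right_cancel₀ (norm_ne_zero_iff.2 h0) this
    · have h1 := ha' g hg (b * t)
      rw [mul_assoc a b t]
      linear_combination f t₀ * h1 + f (a * t₀) * hb' g hg t - g t * hab
  inv_mem' := by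
    rintro a ⟨ha, ha'⟩
    have ha0 : f (a * t₀) ≠ 0 := norm_ne_zero_iff.1 (ha ▸ norm_ne_zero_iff.2 h0)
    have h2 : f t₀ * f t₀ = f (a * t₀) * f (a⁻¹ * t₀) := by
      have := ha' f hf (a⁻¹ * t₀)
      rwa [mul_inv_cancel_left] at this
    refine ⟨?_, fun g hg t => mul_left_cancel₀ ha0 ?_⟩
    · have := congrArg norm h2
      rw [norm_mul, norm_mul, ha] at this
      exact (mul_left_cancel₀ (norm_ne_zero_iff.2 h0) this).symm
    · have h1 := ha' g hg (a⁻¹ * t)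
      rw [mul_inv_cancel_left] at h1
      linear_combination (-f t₀) * h1 + g t * h2

theorem isClosed_eigenSubgroup (𝓕 : Set (G →ᵇ ℂ)) {f : G →ᵇ ℂ} (hf : f ∈ 𝓕) {t₀ : G}
    (h0 : f t₀ ≠ 0) : IsClosed (eigenSubgroup 𝓕 hf h0 : Set G) := by
  have h1 : ∀ (g : G →ᵇ ℂ) t, Continuous fun s => g (s * t) := fun g t =>
    g.continuous.comp (continuous_mul_const t)
  refine (isClosed_eq (h1 f t₀).norm continuous_const).inter ?_
  change IsClosed {s | ∀ g ∈ 𝓕, ∀ t, g (s * t) * f t₀ = f (s * t₀) * g t}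
  simp only [Set.ofPred_forall]
  exact isClosed_iInter fun g => isClosed_iInter fun _ => isClosed_iInter fun t =>
    isClosed_eq ((h1 g t).mul continuous_const) ((h1 f t₀).mul continuous_const)

/-- `WAP(G)` is stable under right translation, scalar multiplication and conjugation. -/
theorem exists_WAP_conj_translate {f : G →ᵇ ℂ} (hf : f ∈ WAP G) (c : ℂ) (t₀ : G) :
    ∃ g ∈ WAP G, ∀ s, g s = starRingEnd ℂ (c * f (s * t₀)) := by
  let R : (G →ᵇ ℂ) → (G →ᵇ ℂ) := fun x => star (c • x.compContinuous (ContinuousMap.mulRight t₀))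
  have hRn : ∀ x, ‖R x‖ ≤ ‖c‖ * ‖x‖ := fun x => by
    rw [norm_star, norm_smul]
    gcongr
    exact (norm_le (norm_nonneg _)).2 fun t => x.norm_coe_le_norm _
  let R' : WeakSpace ℂ (G →ᵇ ℂ) → WeakSpace ℂ (G →ᵇ ℂ) := fun x =>
    toWeakSpace ℂ _ (R ((toWeakSpace ℂ _).symm x))
  have hR' : Continuous R' := by
    refine WeakBilin.continuous_of_continuous_eval _ fun Λ => ?_
    let Λ' : StrongDual ℂ (G →ᵇ ℂ) := LinearMap.mkContinuous
      { toFun := fun x => starRingEnd ℂ (Λ (R x))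
        map_add' := fun x y => by
          have : R (x + y) = R x + R y := by ext t; simp [R, mul_add]
          rw [this, map_add, map_add]
        map_smul' := fun a x => by
          have : R (a • x) = (starRingEnd ℂ a) • R x := by ext t; simp [R]; ring
          rw [this, map_smul, smul_eq_mul, map_mul, Complex.conj_conj]; rfl }
      (‖Λ‖ * ‖c‖) fun x => by
      change ‖starRingEnd ℂ (Λ (R x))‖ ≤ _
      rw [RCLike.norm_conj, mul_assoc]
      exact (Λ.le_opNorm _).trans (mul_le_mul_of_nonneg_left (hRn x) (norm_nonneg _))
    have h1 : Continuous fun x : WeakSpace ℂ (G →ᵇ ℂ) =>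
        starRingEnd ℂ (Λ' ((toWeakSpace ℂ (G →ᵇ ℂ)).symm x)) :=
      Complex.continuous_conj.comp (continuous_dual_toWeakSpace_symm Λ')
    refine h1.congr fun x => ?_
    change starRingEnd ℂ (starRingEnd ℂ (Λ (R ((toWeakSpace ℂ (G →ᵇ ℂ)).symm x)))) = _
    rw [Complex.conj_conj]; rfl
  refine ⟨R f, ?_, fun s => rfl⟩
  have hcomp : IsCompact (R' '' weakOrbit f) := IsCompact.image hf hR'
  refine hcomp.of_isClosed_subset isClosed_closure (closure_minimal ?_ hcomp.isClosed)
  rintro _ ⟨_, ⟨u, rfl⟩, rfl⟩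
  refine ⟨_, leftTranslate_mem_weakOrbit u f, ?_⟩
  change toWeakSpace ℂ _ (R (leftTranslate u f)) = toWeakSpace ℂ _ (leftTranslate u (R f))
  congr 1
  ext t
  simp [R, mul_assoc]

variable [MeasurableSpace G]

theorem generatedSubgroup_le_eigenSubgroup {μ : Measure G} {h : G → ℂ} (h1 : ∀ x, ‖h x‖ = 1)
    {𝓕 : Set (G →ᵇ ℂ)} (h𝓕 : ∀ g ∈ 𝓕, ∀ t, ∀ᵐ s ∂μ, h s * g (s * t) = g t)
    {f : G →ᵇ ℂ} (hf : f ∈ 𝓕) {t₀ : G} (h0 : f t₀ ≠ 0) :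
    generatedSubgroup μ ≤ eigenSubgroup 𝓕 hf h0 := by
  have hc : ∀ (g : G →ᵇ ℂ) t, Continuous fun s => g (s * t) := fun g t =>
    g.continuous.comp (continuous_mul_const t)
  refine Subgroup.topologicalClosure_minimal _ ?_ (isClosed_eigenSubgroup 𝓕 hf h0)
  rw [Subgroup.closure_le]
  intro s hs
  constructor
  · refine Measure.support_subset_of_isClosed (t := {s | ‖f (s * t₀)‖ = ‖f t₀‖})
      (isClosed_eq (hc f t₀).norm continuous_const) ?_ hs
    filter_upwards [h𝓕 f hf t₀] with s hs
    simpa [h1] using congrArg norm hs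
  · intro g hg t
    refine Measure.support_subset_of_isClosed
      (t := {s | g (s * t) * f t₀ = f (s * t₀) * g t})
      (isClosed_eq ((hc g t).mul continuous_const) ((hc f t₀).mul continuous_const)) ?_ hs
    filter_upwards [h𝓕 f hf t₀, h𝓕 g hg t] with s hs hs'
    rw [← hs, ← hs']; ring

/-- The relation `h(s) f(st) = f(t)` for almost all `s` turns the density `h` into a character of
the subgroup generated by the support, which does not depend on the function `f`. -/
theorem exists_character {μ : Measure G} [μ.Regular] {h : G → ℂ} (h1 : ∀ x, ‖h x‖ = 1)
    {f : G →ᵇ ℂ} (hf : ∀ t, ∀ᵐ s ∂μ, h s * f (s * t) = f t) {t₀ : G} (h0 : f t₀ ≠ 0) :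
    ∃ χ : generatedSubgroup μ →ₜ* Circle,
      (∀ s : generatedSubgroup μ, (χ s : ℂ) = starRingEnd ℂ ((f t₀)⁻¹ * f (s * t₀))) ∧
      (∀ g : G →ᵇ ℂ, (∀ t, ∀ᵐ s ∂μ, h s * g (s * t) = g t) →
        ∀ (s : generatedSubgroup μ) (t : G), g (s * t) = starRingEnd ℂ (χ s : ℂ) * g t) ∧
      ∀ᵐ s ∂μ, ∃ hs : s ∈ generatedSubgroup μ, h s = χ ⟨s, hs⟩ := by
  set 𝓕 : Set (G →ᵇ ℂ) := {g | ∀ t, ∀ᵐ s ∂μ, h s * g (s * t) = g t}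
  have hmem : ∀ s : generatedSubgroup μ, ‖f (s * t₀)‖ = ‖f t₀‖ ∧
      ∀ g ∈ 𝓕, ∀ t, g (s * t) * f t₀ = f (s * t₀) * g t := fun s =>
    generatedSubgroup_le_eigenSubgroup h1 (𝓕 := 𝓕) (fun g hg => hg) hf h0 s.2
  have hnorm : ∀ s : generatedSubgroup μ, ‖starRingEnd ℂ ((f t₀)⁻¹ * f (s * t₀))‖ = 1 := fun s => by
    rw [RCLike.norm_conj, norm_mul, norm_inv, (hmem s).1,
      inv_mul_cancel₀ (norm_ne_zero_iff.2 h0)]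
  let χ : generatedSubgroup μ →ₜ* Circle :=
    { toFun := fun s => ⟨_, mem_sphere_zero_iff_norm.2 (hnorm s)⟩
      map_one' := by
        apply Circle.ext
        change starRingEnd ℂ ((f t₀)⁻¹ * f (((1 : generatedSubgroup μ) : G) * t₀)) = 1
        simp [h0]
      map_mul' := fun a b => by
        apply Circle.ext
        change starRingEnd ℂ ((f t₀)⁻¹ * f (((a * b : generatedSubgroup μ) : G) * t₀)) =
          starRingEnd ℂ ((f t₀)⁻¹ * f (a * t₀)) * starRingEnd ℂ ((f t₀)⁻¹ * f (b * t₀))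
        rw [← map_mul]
        congr 1
        have := (hmem a).2 f hf (b * t₀)
        rw [Subgroup.coe_mul, mul_assoc]
        field_simp
        rw [mul_comm (f t₀)]
        exact this
      continuous_toFun := by
        refine Continuous.subtype_mk ?_ _
        exact Complex.continuous_conj.comp (continuous_const.mul
          (f.continuous.comp ((continuous_mul_const t₀).comp continuous_subtype_val))) }
  have hχ : ∀ s : generatedSubgroup μ, (χ s : ℂ) = starRingEnd ℂ ((f t₀)⁻¹ * f (s * t₀)) :=
    fun _ => rfl
  refine ⟨χ, hχ, fun g hg s t => ?_, ?_⟩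
  · rw [hχ, Complex.conj_conj]
    have := (hmem s).2 g hg t
    field_simp
    exact this
  · filter_upwards [Measure.support_mem_ae_of_regular (μ := μ), hf t₀] with s hs hs'
    have hsG : s ∈ generatedSubgroup μ :=
      Subgroup.le_topologicalClosure _ (Subgroup.subset_closure hs)
    refine ⟨hsG, ?_⟩
    have hn := hnorm ⟨s, hsG⟩
    rw [RCLike.norm_conj] at hn
    have h2 : h s * ((f t₀)⁻¹ * f (s * t₀)) = 1 := by
      rw [mul_left_comm, hs', inv_mul_cancel₀ h0]
    rw [hχ, ← inv_eq_of_mul_eq_one_left h2, Complex.inv_def, Complex.normSq_eq_norm_sq, hn]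
    simp

end Character

/-! ### Fixed points and characters -/

/-- A non-zero fixed point forces the contraction to have norm one. -/
theorem isProbabilityMeasure_of_fixedPoint {G : Type*} [Mul G] [TopologicalSpace G]
    [MeasurableSpace G] {μ : Measure G} {h : G → ℂ} (hμ : μ Set.univ ≤ 1)
    (h1 : ∀ x, ‖h x‖ = 1) {f : G →ᵇ ℂ} (hf : ∀ t, ∫ s, f (s * t) * h s ∂μ = f t) (hne : f ≠ 0) :
    IsProbabilityMeasure μ := by
  have : IsFiniteMeasure μ := ⟨hμ.trans_lt ENNReal.one_lt_top⟩
  have hle : ‖f‖ ≤ ‖f‖ * μ.real Set.univ := by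
    refine (norm_le (by positivity)).2 fun t => ?_
    rw [← hf t]
    refine norm_integral_le_of_norm_le_const (Filter.Eventually.of_forall fun s => ?_)
    rw [norm_mul, h1, mul_one]
    exact f.norm_coe_le_norm _
  refine ⟨le_antisymm hμ ?_⟩
  have h2 : 1 ≤ μ.real Set.univ := by
    by_contra! hlt
    have : ‖f‖ * μ.real Set.univ < ‖f‖ := mul_lt_of_lt_one_right (norm_pos_iff.2 hne) hlt
    linarith
  rw [measureReal_def] at h2
  simpa using (ENNReal.ofReal_le_iff_le_toReal (measure_ne_top μ _)).2 h2

section Fixed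
variable {G : Type*} [Group G] [TopologicalSpace G] [IsTopologicalGroup G]
  [MeasurableSpace G] {ω : ComplexMeasure G} {h : G → ℂ}

theorem fixed_of_character {μ : Measure G} [IsProbabilityMeasure μ]
    {χ : generatedSubgroup μ →ₜ* Circle}
    (hχ : ∀ᵐ s ∂μ, ∃ hs : s ∈ generatedSubgroup μ, h s = χ ⟨s, hs⟩) {g : G →ᵇ ℂ}
    (hg : ∀ (s : generatedSubgroup μ) (t : G), g (s * t) = starRingEnd ℂ (χ s : ℂ) * g t) (t : G) :
    ∫ s, g (s * t) * h s ∂μ = g t := by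
  have : (fun s => g (s * t) * h s) =ᵐ[μ] fun _ => g t := by
    filter_upwards [hχ] with s ⟨hs, hsχ⟩
    have h2 := hg ⟨s, hs⟩ t
    simp only at h2
    rw [h2, hsχ, mul_right_comm, mul_comm (starRingEnd ℂ _), Complex.mul_conj,
      Complex.normSq_eq_norm_sq, Circle.norm_coe]
    simp
  rw [integral_congr_ae this]; simp

theorem eq_charMeasure {μ : Measure G} (hω : ω = μ.withDensityᵥ h)
    {χ : generatedSubgroup μ →ₜ* Circle}
    (hχ : ∀ᵐ s ∂μ, ∃ hs : s ∈ generatedSubgroup μ, h s = χ ⟨s, hs⟩) :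
    ω = charMeasure (generatedSubgroup μ) χ μ := by
  rw [hω, charMeasure]
  apply WithDensityᵥEq.congr_ae
  filter_upwards [hχ] with s ⟨hs, hsχ⟩
  rw [hsχ]
  exact (Subtype.val_injective.extend_apply (fun s : generatedSubgroup μ => (χ s : ℂ)) 0
    ⟨s, hs⟩).symm

variable [BorelSpace G]

theorem mem_fixedPoints_iff [IsFiniteMeasure ω.variation] (hm : Measurable h) (h1 : ∀ x, ‖h x‖ = 1)
    (hω : ω = ω.variation.withDensityᵥ h) {f : G →ᵇ ℂ} :
    f ∈ fixedPoints ω ↔ ∀ t, ∫ s, f (s * t) * h s ∂ω.variation = f t := by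
  rw [← funext_iff (f := fun t => ∫ s, f (s * t) * h s ∂ω.variation)]
  have : convOp ω f = fun t => ∫ s, f (s * t) * h s ∂ω.variation := by
    ext t
    exact ComplexMeasure.integral_mul_eq_integral_density hm h1 hω (integrable_translate _ t f)
  rw [← this]; rfl

end Fixed

end ConvFix

theorem mainTheorem7 {G : Type*} [Group G] [TopologicalSpace G] [IsTopologicalGroup G]
    [LocallyCompactSpace G] [T2Space G] [MeasurableSpace G] [BorelSpace G]
    (ω : ComplexMeasure G) (hreg : ω.variation.Regular) (hω : ω.variation Set.univ ≤ 1) :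
    ((∀ a b : G, a * b = b * a) →
      (∃ f ∈ ConvFix.fixedPoints ω ∩ ConvFix.LUC G, f ≠ 0) →
      ∃ χ : ConvFix.generatedSubgroup ω.variation →ₜ* Circle,
        ω = ConvFix.charMeasure (ConvFix.generatedSubgroup ω.variation) χ ω.variation ∧
        ConvFix.fixedPoints ω ∩ ConvFix.LUC G =
          ConvFix.LUCChar (ConvFix.generatedSubgroup ω.variation) χ) ∧
    ((∃ f ∈ ConvFix.fixedPoints ω ∩ ConvFix.WAP G, f ≠ 0) →
      ∃ χ : ConvFix.generatedSubgroup ω.variation →ₜ* Circle,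
        ω = ConvFix.charMeasure (ConvFix.generatedSubgroup ω.variation) χ ω.variation ∧
        ConvFix.fixedPoints ω ∩ ConvFix.WAP G =
          ConvFix.WAPChar (ConvFix.generatedSubgroup ω.variation) χ ∧
        ∃ g ∈ ConvFix.WAP G, ∀ s : ConvFix.generatedSubgroup ω.variation,
          g (s : G) = (χ s : ℂ)) := by
  have : IsFiniteMeasure ω.variation := ⟨hω.trans_lt ENNReal.one_lt_top⟩
  obtain ⟨h, hm, h1, hωh⟩ := ω.exists_unimodular_density
  have hfix := fun f : G →ᵇ ℂ => ConvFix.mem_fixedPoints_iff hm h1 hωh (f := f)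
  constructor
  · rintro hcomm ⟨f, ⟨hfF, hfL⟩, hne⟩
    have := ConvFix.isProbabilityMeasure_of_fixedPoint hω h1 ((hfix f).1 hfF) hne
    obtain ⟨t₀, h0⟩ : ∃ t, f t ≠ 0 := DFunLike.ne_iff.1 hne
    have hrel : ∀ g ∈ ConvFix.fixedPoints ω ∩ ConvFix.LUC G, ∀ t, ∀ᵐ s ∂ω.variation,
        h s * g (s * t) = g t := fun g hg =>
      ConvFix.ae_mul_eq_of_LUC hcomm hm h1 hg.2 ((hfix g).1 hg.1)
    obtain ⟨χ, -, hχ, hχh⟩ := ConvFix.exists_character h1 (hrel f ⟨hfF, hfL⟩) h0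
    refine ⟨χ, ConvFix.eq_charMeasure hωh hχh, Set.Subset.antisymm ?_ ?_⟩
    · exact fun g hg => ⟨hg.2, hχ g (hrel g hg)⟩
    · exact fun g hg => ⟨(hfix g).2 (ConvFix.fixed_of_character hχh hg.2), hg.1⟩
  · rintro ⟨f, ⟨hfF, hfW⟩, hne⟩
    have := ConvFix.isProbabilityMeasure_of_fixedPoint hω h1 ((hfix f).1 hfF) hne
    obtain ⟨t₀, h0⟩ : ∃ t, f t ≠ 0 := DFunLike.ne_iff.1 hne
    have hrel : ∀ g ∈ ConvFix.fixedPoints ω ∩ ConvFix.WAP G, ∀ t, ∀ᵐ s ∂ω.variation,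
        h s * g (s * t) = g t := fun g hg t => by
      filter_upwards [ConvFix.ae_smul_leftTranslate_eq_of_WAP hm h1 hg.2 ((hfix g).1 hg.1)]
        with s hs
      exact DFunLike.congr_fun hs t
    obtain ⟨χ, hχt, hχ, hχh⟩ := ConvFix.exists_character h1 (hrel f ⟨hfF, hfW⟩) h0
    refine ⟨χ, ConvFix.eq_charMeasure hωh hχh, Set.Subset.antisymm ?_ ?_, ?_⟩
    · exact fun g hg => ⟨hg.2, ConvFix.WAP_subset_LUC hg.2, hχ g (hrel g hg)⟩
    · exact fun g hg => ⟨(hfix g).2 (ConvFix.fixed_of_character hχh hg.2.2), hg.1⟩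
    · obtain ⟨g, hg, hgs⟩ := ConvFix.exists_WAP_conj_translate hfW (f t₀)⁻¹ t₀
      exact ⟨g, hg, fun s => by rw [hgs, hχt]⟩
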